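/- Let $M$ be a monoid. An atom of $M$ is an element $a\ne 1$ such that $a=bc$ implies $b=1$ or $c=1$; let $\|a\|$ be the supremum of the lengths of all expressions of $a$ as a product of atoms. $M$ is atomic if it is generated by its atoms and $\|a\|<\infty$ for all $a\in M$. Write $a\le_L b$ if $ac=b$ for some $c\in M$, and $a\le_R b$ if $ca=b$ for some $c\in M$. A Garside monoid is a finitely generated, left and right cancellative, atomic monoid $M$ such that $(M,\le_L)$ and $(M,\le_R)$ are lattices and which has a Garside element, i.e. an element $\Delta\in M$ such that, for every $a\in M$, $a\le_L\Delta$ if and only if $a\le_R\Delta$, and such that $\mathcal D=\{a\in M: a\le_L\Delta\}$ generates $M$. The elements of $\mathcal D$ are called simple elements. Let $G$ be a Garside group, that is, the group of fractions of a Garside monoid $G^+$ (regarded as a submonoid of $G$), with Garside element $\Delta\in G^+$ and set $\mathcal D$ of simple elements. For $g,h\in G$ write $g\le_L h$ if $gc=h$ for some $c\in G^+$, and put $$\inf(g)=\max\{r\in\mathbb Z:\Delta^r\le_L g\},\qquad \sup(g)=\min\{s\in\mathbb Z: g\le_L\Delta^s\}.$$ Let $[g]=\{x^{-1}gx:x\in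 G\}$ be the conjugacy class of $g$, and put $$\inf\nolimits_s(g)=\max\{\inf(h):h\in[g]\},\qquad \sup\nolimits_s(g)=\min\{\sup(h):h\in[g]\},$$ $$[g]^S=\{h\in[g]:\inf(h)=\inf\nolimits_s(g)\text{ and }\sup(h)=\sup\nolimits_s(g)\},$$ $$t_{\inf}(g)=\lim_{n\to\infty}\frac{\inf(g^n)}{n},\qquad t_{\sup}(g)=\lim_{n\to\infty}\frac{\sup(g^n)}{n}.$$ (These maxima, minima and limits exist if $G$ is nontrivial; for trivial $G$ put $\inf=\sup=0$.) For $g\in G$ let $|g|_{\mathcal D}$ be the shortest length of a word in the alphabet $\mathcal D\cup\mathcal D^{-1}$ that represents $g$ (so $|1|_{\mathcal D}=0$), and call $g$ periodically geodesic with respect to $\mathcal D$ if $|g^n|_{\mathcal D}=|n|\cdot|g|_{\mathcal D}$ for all $n\in\mathbb Z$. **Lemma.** Let $g\in G$. Every element $h\in[g]^S$ is periodically geodesic with respect to $\mathcal D$ if one of the following conditions holds: (i) $\inf_s(g)\ge 0$ and $t_{\sup}(g)$ is an integer; (ii) $\sup_s(g)\le 0$ and $t_{\inf}(g)$ is an integer;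 (iii) both $t_{\inf}(g)$ and $t_{\sup}(g)$ are integers. -/

import Mathlib

noncomputable section

namespace Garside

/-! ### Garside monoids -/

section Monoid

variable {M : Type*} [Monoid M]

/-- An atom of a monoid: an element `a ≠ 1` such that `a = b * c` forces `b = 1` or `c = 1`. -/
def IsMonoidAtom (a : M) : Prop :=
  a ≠ 1 ∧ ∀ b c : M, a = b * c → b = 1 ∨ c = 1

/-- `‖a‖`: the supremum (in `ℕ∞`) of the lengths of all expressions of `a` as a product of atoms. -/
def atomNorm (a : M) : ℕ∞ :=
  ⨆ l ∈ {l : List M | (∀ x ∈ l, IsMonoidAtom x) ∧ l.prod = a}, (l.length : ℕ∞)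

/-- A monoid is atomic if it is generated by its atoms and `‖a‖ < ∞` for every `a`. -/
structure IsAtomic (M : Type*) [Monoid M] : Prop where
  closure_atoms : Submonoid.closure {a : M | IsMonoidAtom a} = ⊤
  atomNorm_lt_top : ∀ a : M, atomNorm a < ⊤

/-- `a ≤_L b` in a monoid: `a * c = b` for some `c`. -/
def LeL (a b : M) : Prop := ∃ c : M, a * c = b

/-- `a ≤_R b` in a monoid: `c * a = b` for some `c`. -/
def LeR (a b : M) : Prop := ∃ c : M, c * a = b

/-- A binary relation that is a partial order in which any two elements have a least upper
bound and a greatest lower bound. -/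
structure IsLatticeOrder {α : Type*} (r : α → α → Prop) : Prop where
  refl : ∀ a, r a a
  trans : ∀ a b c, r a b → r b c → r a c
  antisymm : ∀ a b, r a b → r b a → a = b
  exists_sup : ∀ a b, ∃ j, r a j ∧ r b j ∧ ∀ c, r a c → r b c → r j c
  exists_inf : ∀ a b, ∃ m, r m a ∧ r m b ∧ ∀ c, r c a → r c b → r c m

/-- A Garside element of a monoid: its left and right divisors coincide, and its left divisors
generate the monoid. -/
structure IsGarsideElement (Δ : M) : Prop where
  leL_iff_leR : ∀ a : M, LeL a Δ ↔ LeR a Δ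
  closure_divisors : Submonoid.closure {a : M | LeL a Δ} = ⊤

/-- Garside monoids. -/
structure IsGarsideMonoid (M : Type*) [Monoid M] : Prop where
  atomic : IsAtomic M
  fg : Monoid.FG M
  cancel : IsCancelMul M
  lattice_leL : IsLatticeOrder (LeL : M → M → Prop)
  lattice_leR : IsLatticeOrder (LeR : M → M → Prop)
  exists_garsideElement : ∃ Δ : M, IsGarsideElement Δ

end Monoid

/-! ### Garside groups -/

section Group

variable {G : Type*} [Group G]

/-- `G` is a Garside group with positive monoid `P` and Garside element `Δ`: `P` is a Garside
monoid (sitting inside `G`), `Δ` is a Garside element of `P`, and `G` is the group of fractions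
of `P`, i.e. every element of `G` is a fraction of elements of `P`. -/
structure IsGarsideGroup (P : Submonoid G) (Δ : P) : Prop where
  garsideMonoid : IsGarsideMonoid P
  garsideElement : IsGarsideElement Δ
  fraction : ∀ g : G, ∃ a b : P, g = (a : G)⁻¹ * (b : G)

/-- The set `𝓓` of simple elements, as a subset of the group: the positive `a` with `a ≤_L Δ`. -/
def simples (P : Submonoid G) (Δ : P) : Set G :=
  {x | ∃ a : P, LeL a Δ ∧ (a : G) = x}

/-- The order `≤_L` of the positive monoid `P` extended to `G`: `g * c = h` for some positive
`c`. -/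
def GroupLeL (P : Submonoid G) (g h : G) : Prop := ∃ c ∈ P, g * c = h

/-- `inf(g) = max {r : ℤ | Δ ^ r ≤_L g}`. -/
def inf (P : Submonoid G) (Δ : P) (g : G) : ℤ :=
  sSup {r : ℤ | GroupLeL P ((Δ : G) ^ r) g}

/-- `sup(g) = min {s : ℤ | g ≤_L Δ ^ s}`. -/
def sup (P : Submonoid G) (Δ : P) (g : G) : ℤ :=
  sInf {s : ℤ | GroupLeL P g ((Δ : G) ^ s)}

/-- `inf_s(g)`, the maximum of `inf` over the conjugacy class of `g`. -/
def infS (P : Submonoid G) (Δ : P) (g : G) : ℤ :=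
  sSup (inf P Δ '' conjugatesOf g)

/-- `sup_s(g)`, the minimum of `sup` over the conjugacy class of `g`. -/
def supS (P : Submonoid G) (Δ : P) (g : G) : ℤ :=
  sInf (sup P Δ '' conjugatesOf g)

/-- The super summit set `[g]^S`. -/
def superSummitSet (P : Submonoid G) (Δ : P) (g : G) : Set G :=
  {h | h ∈ conjugatesOf g ∧ inf P Δ h = infS P Δ g ∧ sup P Δ h = supS P Δ g}

/-- `t_inf(g) = lim inf(g ^ n) / n` as `n → ∞`. -/
def tInf (P : Submonoid G) (Δ : P) (g : G) : ℝ :=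
  Filter.limUnder Filter.atTop (fun n : ℕ => (inf P Δ (g ^ n) : ℝ) / (n : ℝ))

/-- `t_sup(g) = lim sup(g ^ n) / n` as `n → ∞`. -/
def tSup (P : Submonoid G) (Δ : P) (g : G) : ℝ :=
  Filter.limUnder Filter.atTop (fun n : ℕ => (sup P Δ (g ^ n) : ℝ) / (n : ℝ))

/-- `|g|_A` for a set `A` of group generators: the shortest length of a word in the alphabet
`A ∪ A⁻¹` that represents `g`; the empty word represents `1`. -/
def wordLength (A : Set G) (g : G) : ℕ :=
  sInf {k : ℕ | ∃ l : List G, (∀ x ∈ l, x ∈ A ∨ x⁻¹ ∈ A) ∧ l.prod = g ∧ l.length = k}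

/-- `g` is periodically geodesic with respect to `A`: `|g ^ n|_A = |n| * |g|_A` for all
integers `n`. -/
def IsPeriodicallyGeodesic (A : Set G) (g : G) : Prop :=
  ∀ n : ℤ, wordLength A (g ^ n) = n.natAbs * wordLength A g

end Group

end Garside

end

namespace Garside

/-! The order `≤_L` is a left-invariant lattice order on `G`. Right multiplication by `Δ` is an
order automorphism, and intervals are finite. Cutting along powers of `Δ` gives `|g| = max 0 (sup g)
+ max 0 (-inf g)` (`wordLength_eq`). Since `sup g = -inf g⁻¹`, everything reduces to showing that
`inf` is linear on the powers of `h` when `t_inf` is an integer `k` and `h` maximises `inf` in its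
class. Superadditivity gives `n * inf h ≤ inf (h ^ n) ≤ n * k`, so it is enough that some conjugate
lies above `Δ ^ k`.

To find it (`exists_conj_zpow_le`), let `y_n` be the meet of `g ^ i * Δ ^ (-k i)` for `i ≤ n`.
Conjugating `g` by `y_n` never leaves a fixed finite interval, so two of these conjugates coincide.
The cocycle rule `powMeet_add` then yields a conjugate `h` commuting with its own meet `w ≤ 1`, and
the later meets along a progression are powers of `w`. If `w = 1`, then `Δ ^ k ≤ h`. If `w < 1`, the
powers of `w` decrease linearly against `Δ` (`exists_not_pow_mul_le`), whereas an integer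
translation number `k` permits only sublinear decrease. -/

/-- A left-invariant lattice order on a group together with an element `Δ > 1` such that right
multiplication by `Δ` is an order automorphism, the powers of `Δ` are coinitial, and all
intervals are finite. -/
structure IsGarsideOrder {G : Type*} [Group G] [Lattice G] (Δ : G) : Prop where
  mulLeftMono : MulLeftMono G
  one_lt : 1 < Δ
  mul_right_le : ∀ {x y : G}, x ≤ y → x * Δ ≤ y * Δ
  mul_right_inv_le : ∀ {x y : G}, x ≤ y → x * Δ⁻¹ ≤ y * Δ⁻¹
  exists_zpow_le : ∀ g : G, ∃ r : ℤ, Δ ^ r ≤ g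
  finite_Icc : ∀ a b : G, (Set.Icc a b).Finite

namespace IsGarsideOrder

/-! ### Comparison with powers of `Δ` -/

section Order

variable {G : Type*} [Group G] [Lattice G] {Δ : G} (H : IsGarsideOrder Δ)
include H

theorem mul_zpow_mono (r : ℤ) {x y : G} (h : x ≤ y) : x * Δ ^ r ≤ y * Δ ^ r := by
  induction r with
  | zero => simpa using h
  | succ n ih => simpa [zpow_add_one, ← mul_assoc] using H.mul_right_le ih
  | pred n ih => simpa [zpow_sub_one, ← mul_assoc] using H.mul_right_inv_le ih

theorem mul_zpow_le_iff (r : ℤ) {x y : G} : x * Δ ^ r ≤ y * Δ ^ r ↔ x ≤ y :=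
  ⟨fun h => by simpa [mul_assoc, ← zpow_add] using H.mul_zpow_mono (-r) h, H.mul_zpow_mono r⟩

theorem mul_zpow_le_iff_le_mul (r : ℤ) {x y : G} : x * Δ ^ r ≤ y ↔ x ≤ y * Δ ^ (-r) := by
  rw [← H.mul_zpow_le_iff r (x := x) (y := y * Δ ^ (-r))]
  simp [mul_assoc]

theorem zpow_strictMono : StrictMono fun r : ℤ => Δ ^ r := by
  have := H.mulLeftMono
  refine strictMono_int_of_lt_succ fun n => ?_
  rw [zpow_add_one]
  exact lt_mul_of_one_lt_right' _ H.one_lt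

theorem zpow_le_zpow_iff {r s : ℤ} : Δ ^ r ≤ Δ ^ s ↔ r ≤ s :=
  H.zpow_strictMono.le_iff_le

/-- Inversion need not reverse a merely left-invariant order, but it does against powers of `Δ`,
which can be moved across on the right. This is the source of the duality between `inf` and `sup`.
-/
theorem inv_le_zpow_iff {g : G} {r : ℤ} : g⁻¹ ≤ Δ ^ (-r) ↔ Δ ^ r ≤ g := by
  have := H.mulLeftMono
  rw [inv_le_iff_one_le_mul', ← H.mul_zpow_le_iff r]
  simp [mul_assoc]

theorem zpow_mul_le {a b : G} {r s : ℤ} (ha : Δ ^ r ≤ a) (hb : Δ ^ s ≤ b) :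
    Δ ^ (r + s) ≤ a * b := by
  have := H.mulLeftMono
  rw [zpow_add]
  exact (H.mul_zpow_mono s ha).trans (mul_le_mul_right hb a)

end Order

/-! ### Linear growth of powers -/

section Growth

variable {G : Type*} [Group G] [Lattice G] {Δ : G} (H : IsGarsideOrder Δ)
include H

/-- Powers of an element `v > 1` are not bounded by slowly growing powers of `Δ`. -/
theorem exists_not_pow_mul_le {v : G} (hv : 1 < v) :
    ∃ n : ℕ, 0 < n ∧ ∀ j : ℕ, 0 < j → ¬ v ^ (n * j) ≤ Δ ^ j := by
  have := H.mulLeftMono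
  set F := (H.finite_Icc 1 Δ).toFinset with hF
  have h1F : (1 : G) ∈ F := by simp [hF, H.one_lt.le]
  refine ⟨F.card, Finset.card_pos.2 ⟨1, h1F⟩, fun j hj hle => ?_⟩
  set n := F.card with hn
  have hne : (Finset.range j).Nonempty := by simpa using hj.ne'
  -- If `v ^ (n * j) ≤ Δ ^ j`, this join is almost invariant: `y ≤ v * y` and `v ^ n * y ≤ y * Δ`.
  -- Conjugating `v` by it gives `d > 1` with `d ^ n ≤ Δ`.
  set y := (Finset.range j).sup' hne (fun i => v ^ (n * i) * Δ ^ (-(i : ℤ))) with hy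
  have hterm : ∀ i < j, v ^ (n * i) * Δ ^ (-(i : ℤ)) ≤ y := fun i hi =>
    Finset.le_sup' (fun i : ℕ => v ^ (n * i) * Δ ^ (-(i : ℤ))) (Finset.mem_range.2 hi)
  have hvy : y ≤ v * y := by
    refine Finset.sup'_le _ _ fun i hi => ?_
    refine le_trans ?_ (mul_le_mul_right (hterm i (Finset.mem_range.1 hi)) v)
    rw [← mul_assoc]
    refine H.mul_zpow_mono _ ?_
    rw [← pow_succ', pow_succ]
    exact le_mul_of_one_le_right' hv.le
  have hny : v ^ n * y ≤ y * Δ := by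
    rw [← le_inv_mul_iff_mul_le]
    refine Finset.sup'_le _ _ fun i hi => ?_
    rw [le_inv_mul_iff_mul_le, ← mul_assoc, ← pow_add]
    have key : v ^ (n * (i + 1)) * Δ ^ (-((i + 1 : ℕ) : ℤ)) ≤ y := by
      rcases Nat.lt_or_ge (i + 1) j with h | h
      · exact hterm _ h
      · have hij : i + 1 = j := le_antisymm (Finset.mem_range.1 hi) h
        rw [hij]
        have h0 := hterm 0 hj
        simp only [mul_zero, pow_zero, Nat.cast_zero, neg_zero, zpow_zero, mul_one] at h0
        refine le_trans ?_ h0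
        have := H.mul_zpow_mono (-(j : ℤ)) hle
        simpa using this
    have := H.mul_zpow_mono 1 key
    have e : v ^ (n * (i + 1)) * Δ ^ (-((i + 1 : ℕ) : ℤ)) * Δ ^ (1 : ℤ) =
        v ^ (n + n * i) * Δ ^ (-(i : ℤ)) := by
      rw [mul_assoc, ← zpow_add]
      congr 2
      · ring
      · push_cast; ring
    rw [e] at this
    simpa using this
  set d := y⁻¹ * v * y with hd
  have hd1 : 1 < d := by
    refine lt_of_le_of_ne ?_ ?_
    · rw [hd, mul_assoc, le_inv_mul_iff_mul_le, mul_one]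
      exact hvy
    · intro h
      apply hv.ne
      have h' : v = y * d * y⁻¹ := by rw [hd]; group
      rw [h', ← h]; group
  have hdn : d ^ n ≤ Δ := by
    have e : d ^ n = y⁻¹ * (v ^ n * y) := by
      have := conj_pow (i := n) (a := y⁻¹) (b := v)
      rw [inv_inv] at this
      rw [hd, this, mul_assoc]
    rw [e, inv_mul_le_iff_le_mul]
    exact hny
  have hmono : StrictMono fun i : ℕ => d ^ i := strictMono_nat_of_lt_succ fun i => by
    rw [pow_succ]; exact lt_mul_of_one_lt_right' _ hd1
  -- The `n + 1` distinct elements `1, d, ..., d ^ n` would all lie in `[1, Δ]`, which has only `n`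
  -- elements.
  have hcard : (Finset.range (n + 1)).card ≤ F.card := by
    refine Finset.card_le_card_of_injOn (fun i => d ^ i) (fun i hi => ?_)
      hmono.injective.injOn
    have hi' : i ≤ n := Nat.lt_succ_iff.1 (by simpa using hi)
    have : (1 : G) ≤ d ^ i := by simpa using hmono.monotone (Nat.zero_le i)
    simp [hF, this, (hmono.monotone hi').trans hdn]
  simp [← hn] at hcard

end Growth

end IsGarsideOrder

/-! ### Meets of normalised powers -/

section PowMeet

variable {G : Type*} [Group G] [Lattice G]

/-- The meet of the elements `g ^ i * Δ ^ (-k i)` for `i ≤ n`. -/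
def powMeet (Δ : G) (k : ℤ) (g : G) (n : ℕ) : G :=
  (Finset.range (n + 1)).inf' Finset.nonempty_range_add_one
    (fun i => g ^ i * Δ ^ (-(k * (i : ℤ))))

theorem le_powMeet_iff {Δ : G} {k : ℤ} {g a : G} {n : ℕ} :
    a ≤ powMeet Δ k g n ↔ ∀ i ≤ n, a ≤ g ^ i * Δ ^ (-(k * (i : ℤ))) := by
  simp [powMeet]

theorem powMeet_le {Δ : G} {k : ℤ} {g : G} {n i : ℕ} (hi : i ≤ n) :
    powMeet Δ k g n ≤ g ^ i * Δ ^ (-(k * (i : ℤ))) :=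
  le_powMeet_iff.1 le_rfl i hi

variable {Δ : G} (H : IsGarsideOrder Δ)
include H

/-- A cocycle rule: left multiplication by `g ^ i` and right multiplication by `Δ ^ (-k i)` preserve
meets, so they carry the meet over `l ≤ N` to the meet over the indices `i + l`. -/
theorem powMeet_add (k : ℤ) (g : G) (N p : ℕ) :
    powMeet Δ k g (N + p) = powMeet Δ k g N *
      powMeet Δ k ((powMeet Δ k g N)⁻¹ * g * powMeet Δ k g N) p := by
  have := H.mulLeftMono
  set y := powMeet Δ k g N with hy
  refine eq_of_forall_le_iff fun a => ?_
  have key : ∀ i : ℕ, a ≤ y * ((y⁻¹ * g * y) ^ i * Δ ^ (-(k * (i : ℤ)))) ↔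
      ∀ l ≤ N, a ≤ g ^ (i + l) * Δ ^ (-(k * ((i + l : ℕ) : ℤ))) := by
    intro i
    have e : (y⁻¹ * g * y) ^ i = y⁻¹ * g ^ i * y := by
      have := conj_pow (i := i) (a := y⁻¹) (b := g)
      rwa [inv_inv] at this
    have e2 : y * ((y⁻¹ * g * y) ^ i * Δ ^ (-(k * (i : ℤ)))) =
        g ^ i * y * Δ ^ (-(k * (i : ℤ))) := by rw [e]; group
    rw [e2, ← H.mul_zpow_le_iff_le_mul, ← inv_mul_le_iff_le_mul, hy, le_powMeet_iff]
    refine forall₂_congr fun l _ => ?_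
    rw [inv_mul_le_iff_le_mul, H.mul_zpow_le_iff_le_mul, ← mul_assoc, ← pow_add, mul_assoc,
      ← zpow_add]
    have e3 : -(k * (l : ℤ)) + -(k * (i : ℤ)) = -(k * ((i + l : ℕ) : ℤ)) := by push_cast; ring
    rw [e3]
  rw [← inv_mul_le_iff_le_mul, le_powMeet_iff, le_powMeet_iff]
  simp only [inv_mul_le_iff_le_mul, key]
  constructor
  · intro h i hi l hl
    exact h _ (by omega)
  · intro h i hi
    have := h (min i p) (min_le_right _ _) (i - min i p) (by omega)
    rwa [show min i p + (i - min i p) = i by omega] at this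

/-- The claim is `y * Δ ^ a ≤ g * y` for the meet `y`, and it holds term by term because powers of
`Δ` commute with each other. With the upper bound below, all these conjugates stay in one finite
interval. -/
theorem zpow_le_conj_powMeet {k a : ℤ} {g : G} {n : ℕ} (ha : Δ ^ a ≤ g) :
    Δ ^ a ≤ (powMeet Δ k g n)⁻¹ * g * powMeet Δ k g n := by
  have := H.mulLeftMono
  set y := powMeet Δ k g n with hy
  rw [mul_assoc, le_inv_mul_iff_mul_le, ← inv_mul_le_iff_le_mul, hy, le_powMeet_iff]
  intro i hi
  rw [inv_mul_le_iff_le_mul]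
  refine (H.mul_zpow_mono a (powMeet_le hi)).trans ?_
  rw [mul_assoc, ← zpow_add, add_comm, zpow_add, ← mul_assoc, ← mul_assoc, ← pow_succ', pow_succ]
  exact H.mul_zpow_mono _ (mul_le_mul_right ha _)

theorem conj_powMeet_le_zpow {k b : ℤ} {g : G} {n : ℕ} (hb : g ≤ Δ ^ b) :
    (powMeet Δ k g n)⁻¹ * g * powMeet Δ k g n ≤ Δ ^ b := by
  have := H.mulLeftMono
  set y := powMeet Δ k g n with hy
  rw [mul_assoc, inv_mul_le_iff_le_mul, ← neg_neg b, ← H.mul_zpow_le_iff_le_mul, hy,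
    le_powMeet_iff]
  intro i hi
  refine (H.mul_zpow_mono (-b) (mul_le_mul_right (powMeet_le hi) g)).trans ?_
  rw [← mul_assoc, ← pow_succ', pow_succ, mul_assoc, mul_assoc, ← zpow_add, add_comm, zpow_add]
  refine mul_le_mul_right ?_ _
  rw [← mul_assoc]
  have h1 : g * Δ ^ (-b) ≤ 1 := by simpa using H.mul_zpow_mono (-b) hb
  simpa using H.mul_zpow_mono (-(k * (i : ℤ))) h1

theorem exists_conj_powMeet_eq (k : ℤ) (g : G) : ∃ N p : ℕ, 0 < p ∧
    (powMeet Δ k g N)⁻¹ * g * powMeet Δ k g N =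
      (powMeet Δ k g (N + p))⁻¹ * g * powMeet Δ k g (N + p) := by
  obtain ⟨a, ha⟩ := H.exists_zpow_le g
  obtain ⟨b, hb⟩ := H.exists_zpow_le g⁻¹
  have hb' : g ≤ Δ ^ (-b) := by simpa using (H.inv_le_zpow_iff (g := g⁻¹)).2 hb
  have hmaps : ∀ n : ℕ, (powMeet Δ k g n)⁻¹ * g * powMeet Δ k g n ∈
      Set.Icc (Δ ^ a) (Δ ^ (-b)) :=
    fun n => ⟨zpow_le_conj_powMeet H ha, conj_powMeet_le_zpow H hb'⟩
  obtain ⟨m, -, n, -, hmn, he⟩ := Set.infinite_univ.exists_ne_map_eq_of_mapsTo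
    (fun n _ => hmaps n) (H.finite_Icc _ _)
  rcases lt_or_gt_of_ne hmn with h | h
  · exact ⟨m, n - m, by omega, by rw [Nat.add_sub_of_le h.le]; exact he⟩
  · exact ⟨n, m - n, by omega, by rw [Nat.add_sub_of_le h.le]; exact he.symm⟩

/-- When the meet commutes with `h`, the conjugation in the cocycle rule is trivial and the cocycle
becomes a homomorphism. -/
theorem powMeet_pow {k : ℤ} {h : G} {p : ℕ} (hc : Commute (powMeet Δ k h p) h) (j : ℕ) :
    powMeet Δ k h (j * p) = powMeet Δ k h p ^ j := by
  induction j with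
  | zero => simp [powMeet]
  | succ j ih =>
    rw [Nat.succ_mul, powMeet_add H, ih]
    have e : (powMeet Δ k h p ^ j)⁻¹ * h * powMeet Δ k h p ^ j = h := by
      rw [mul_assoc, ← (hc.pow_left j).eq]; group
    rw [e, pow_succ]

/-- Some conjugate of `g` lies above `Δ ^ k` as soon as the powers of every conjugate of `g` lie
above `Δ ^ (k n - o(n))`. -/
theorem exists_conj_zpow_le {k : ℤ} {g : G}
    (hg : ∀ y : G, ∀ C : ℕ, 0 < C → ∃ j : ℕ, 0 < j ∧ ∀ i ≤ C * j,
      Δ ^ (k * (i : ℤ) - j) ≤ (y⁻¹ * g * y) ^ i) :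
    ∃ y : G, Δ ^ k ≤ y⁻¹ * g * y := by
  have := H.mulLeftMono
  obtain ⟨N, p, hp, he⟩ := exists_conj_powMeet_eq H k g
  set y := powMeet Δ k g N with hy
  set h := y⁻¹ * g * y with hh
  set w := powMeet Δ k h p with hw
  have hc : Commute w h := by
    rw [powMeet_add H, ← hy, ← hh, ← hw] at he
    have : h = w⁻¹ * h * w := by
      conv_lhs => rw [he]
      rw [hh]; group
    change w * h = h * w
    conv_lhs => rw [this]
    group
  have hw1 : w ≤ 1 := by simpa using powMeet_le (Δ := Δ) (k := k) (g := h) (Nat.zero_le p)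
  rcases hw1.eq_or_lt with hw1 | hw1
  · refine ⟨y, ?_⟩
    have := powMeet_le (Δ := Δ) (k := k) (g := h) (n := p) (i := 1) hp
    rw [← hw, hw1] at this
    have h1 : 1 * Δ ^ k ≤ h := (H.mul_zpow_le_iff_le_mul k).2 (by simpa using this)
    rwa [one_mul] at h1
  · obtain ⟨n, hn, hcon⟩ := H.exists_not_pow_mul_le (one_lt_inv_of_inv hw1)
    -- With `C = n * p` the bound covers every exponent entering `w ^ (n * j)`, which is the meet
    -- over `i ≤ n * j * p`.
    obtain ⟨j, hj, hle⟩ := hg y (n * p) (by positivity)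
    refine absurd ?_ (hcon j hj)
    have h1 : Δ ^ (-(j : ℤ)) ≤ w ^ (n * j) := by
      rw [hw, ← powMeet_pow H hc, le_powMeet_iff]
      intro i hi
      rw [← H.mul_zpow_le_iff_le_mul, ← zpow_add]
      refine le_trans (le_of_eq ?_) (hle i (hi.trans (le_of_eq (by ring))))
      congr 1; ring
    have := H.inv_le_zpow_iff.2 h1
    simpa using this

end PowMeet

/-! ### Translation numbers -/

open Filter Topology

/-- The largest `r` with `Δ ^ r ≤ g`, for an arbitrary order on a group. -/
noncomputable def ordInf {G : Type*} [Group G] [Lattice G] (Δ g : G) : ℤ := sSup {r : ℤ | Δ ^ r ≤ g}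

/-- The least `s` with `g ≤ Δ ^ s`, for an arbitrary order on a group. -/
noncomputable def ordSup {G : Type*} [Group G] [Lattice G] (Δ g : G) : ℤ := sInf {s : ℤ | g ≤ Δ ^ s}

namespace IsGarsideOrder

variable {G : Type*} [Group G] [Lattice G] {Δ : G} (H : IsGarsideOrder Δ)
include H

theorem le_zpow_neg_iff {g : G} {r : ℤ} : g ≤ Δ ^ (-r) ↔ Δ ^ r ≤ g⁻¹ := by
  rw [← H.inv_le_zpow_iff, inv_inv]

theorem bddAbove_zpow_le (g : G) : BddAbove {r : ℤ | Δ ^ r ≤ g} := by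
  obtain ⟨s, hs⟩ := H.exists_zpow_le g⁻¹
  exact ⟨-s, fun r hr => H.zpow_le_zpow_iff.1 (le_trans hr (H.le_zpow_neg_iff.2 hs))⟩

theorem le_ordInf_iff {g : G} {r : ℤ} : r ≤ ordInf Δ g ↔ Δ ^ r ≤ g := by
  refine ⟨fun h => ?_, fun h => le_csSup (H.bddAbove_zpow_le g) h⟩
  exact (H.zpow_le_zpow_iff.2 h).trans
    (Int.csSup_mem (H.exists_zpow_le g) (H.bddAbove_zpow_le g) : Δ ^ ordInf Δ g ≤ g)

theorem ordSup_eq (g : G) : ordSup Δ g = -ordInf Δ g⁻¹ := by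
  have h : IsLeast {s : ℤ | g ≤ Δ ^ s} (-ordInf Δ g⁻¹) := by
    constructor
    · exact H.le_zpow_neg_iff.2 (H.le_ordInf_iff.1 le_rfl)
    · intro s hs
      have : -s ≤ ordInf Δ g⁻¹ := H.le_ordInf_iff.2 (H.le_zpow_neg_iff.1 (by simpa using hs))
      linarith
  exact h.csInf_eq

theorem ordSup_le_iff {g : G} {s : ℤ} : ordSup Δ g ≤ s ↔ g ≤ Δ ^ s := by
  rw [H.ordSup_eq, neg_le, H.le_ordInf_iff, ← H.le_zpow_neg_iff, neg_neg]

theorem ordInf_add_le (a b : G) : ordInf Δ a + ordInf Δ b ≤ ordInf Δ (a * b) :=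
  H.le_ordInf_iff.2 (H.zpow_mul_le (H.le_ordInf_iff.1 le_rfl) (H.le_ordInf_iff.1 le_rfl))

theorem ordSup_le_add (a b : G) : ordSup Δ (a * b) ≤ ordSup Δ a + ordSup Δ b := by
  have := H.ordInf_add_le b⁻¹ a⁻¹
  rw [H.ordSup_eq, H.ordSup_eq, H.ordSup_eq, mul_inv_rev]
  linarith

theorem ordInf_le_ordSup (g : G) : ordInf Δ g ≤ ordSup Δ g :=
  H.zpow_le_zpow_iff.1 ((H.le_ordInf_iff.1 le_rfl).trans (H.ordSup_le_iff.1 le_rfl))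

theorem ordInf_one : ordInf Δ 1 = 0 := by
  refine eq_of_forall_le_iff fun r => ?_
  rw [H.le_ordInf_iff, ← H.zpow_le_zpow_iff, zpow_zero]

theorem mul_ordInf_le_pow (g : G) (n : ℕ) : n * ordInf Δ g ≤ ordInf Δ (g ^ n) := by
  induction n with
  | zero => simp [H.ordInf_one]
  | succ n ih =>
    have := H.ordInf_add_le (g ^ n) g
    rw [pow_succ]; push_cast; linarith

theorem pow_ordSup_le_mul (g : G) (n : ℕ) : ordSup Δ (g ^ n) ≤ n * ordSup Δ g := by
  have := H.mul_ordInf_le_pow g⁻¹ n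
  rw [H.ordSup_eq, H.ordSup_eq, ← inv_pow]
  linarith

/-- The translation number of `g` exists and bounds the `inf` of all powers of `g`. -/
theorem exists_tendsto_ordInf (g : G) :
    ∃ t : ℝ, Tendsto (fun n : ℕ => (ordInf Δ (g ^ n) : ℝ) / n) atTop (𝓝 t) ∧
      ∀ n : ℕ, (ordInf Δ (g ^ n) : ℝ) ≤ n * t := by
  set u : ℕ → ℝ := fun n => -(ordInf Δ (g ^ n) : ℝ) with hu
  have hsub : Subadditive u := fun m n => by
    have : (ordInf Δ (g ^ m) : ℝ) + ordInf Δ (g ^ n) ≤ ordInf Δ (g ^ (m + n)) := by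
      rw [pow_add]; exact_mod_cast H.ordInf_add_le _ _
    simp only [hu]; linarith
  have hbdd : BddBelow (Set.range fun n => u n / n) := by
    -- The absolute value also covers `n = 0`, where the quotient is `0` by convention.
    refine ⟨-|(ordSup Δ g : ℝ)|, ?_⟩
    rintro _ ⟨n, rfl⟩
    rcases Nat.eq_zero_or_pos n with rfl | hn
    · simp
    · have hn' : (0 : ℝ) < n := by exact_mod_cast hn
      have h1 : (ordInf Δ (g ^ n) : ℝ) ≤ n * ordSup Δ g := by
        exact_mod_cast (H.ordInf_le_ordSup _).trans (H.pow_ordSup_le_mul g n)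
      have h2 := mul_le_mul_of_nonneg_left (le_abs_self (ordSup Δ g : ℝ)) hn'.le
      change _ ≤ u n / n
      rw [le_div_iff₀ hn']
      simp only [hu]; linarith
  refine ⟨-hsub.lim, ?_, fun n => ?_⟩
  · refine ((hsub.tendsto_lim hbdd).neg).congr fun n => ?_
    simp only [hu]; ring
  · rcases Nat.eq_zero_or_pos n with rfl | hn
    · simp [H.ordInf_one]
    · have hn' : (0 : ℝ) < n := by exact_mod_cast hn
      have := hsub.lim_le_div hbdd hn.ne'
      rw [le_div_iff₀ hn'] at this
      simp only [hu] at this; linarith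

/-- Conjugation changes `inf (g ^ n)` by an amount bounded independently of `n`, which disappears
after division by `n`. -/
theorem tendsto_ordInf_conj {g : G} {t : ℝ}
    (ht : Tendsto (fun n : ℕ => (ordInf Δ (g ^ n) : ℝ) / n) atTop (𝓝 t)) (y : G) :
    Tendsto (fun n : ℕ => (ordInf Δ ((y⁻¹ * g * y) ^ n) : ℝ) / n) atTop (𝓝 t) := by
  have hpow : ∀ n : ℕ, (y⁻¹ * g * y) ^ n = y⁻¹ * g ^ n * y := fun n => by
    have := conj_pow (i := n) (a := y⁻¹) (b := g)
    rwa [inv_inv] at this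
  set c : ℝ := ordInf Δ y⁻¹ + ordInf Δ y with hc
  have hlo : ∀ n : ℕ, (ordInf Δ (g ^ n) : ℝ) + c ≤ ordInf Δ ((y⁻¹ * g * y) ^ n) := fun n => by
    have h1 := H.ordInf_add_le (y⁻¹ * g ^ n) y
    have h2 := H.ordInf_add_le y⁻¹ (g ^ n)
    rw [hpow, hc]
    exact_mod_cast (by linarith :
      ordInf Δ (g ^ n) + (ordInf Δ y⁻¹ + ordInf Δ y) ≤ ordInf Δ (y⁻¹ * g ^ n * y))
  have hhi : ∀ n : ℕ, (ordInf Δ ((y⁻¹ * g * y) ^ n) : ℝ) ≤ ordInf Δ (g ^ n) - c := fun n => by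
    have h1 := H.ordInf_add_le (y * (y⁻¹ * g ^ n * y)) y⁻¹
    have h2 := H.ordInf_add_le y (y⁻¹ * g ^ n * y)
    rw [show y * (y⁻¹ * g ^ n * y) * y⁻¹ = g ^ n by group] at h1
    rw [hpow, hc]
    exact_mod_cast (by linarith :
      ordInf Δ (y⁻¹ * g ^ n * y) ≤ ordInf Δ (g ^ n) - (ordInf Δ y⁻¹ + ordInf Δ y))
  have hc0 : Tendsto (fun n : ℕ => c / (n : ℝ)) atTop (𝓝 0) :=
    tendsto_const_div_atTop_nhds_zero_nat c
  have hl := ht.add hc0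
  have hr := ht.sub hc0
  rw [add_zero] at hl
  rw [sub_zero] at hr
  refine tendsto_of_tendsto_of_tendsto_of_le_of_le hl hr (fun n => ?_) (fun n => ?_)
  · simp only
    rw [← add_div]
    exact div_le_div_of_nonneg_right (hlo n) (Nat.cast_nonneg n)
  · simp only
    rw [← sub_div]
    exact div_le_div_of_nonneg_right (hhi n) (Nat.cast_nonneg n)

/-- If the translation number of `g` is an integer, it is attained as the `inf` of some
conjugate. -/
theorem exists_le_ordInf_conj {g : G} {k : ℤ}
    (ht : Tendsto (fun n : ℕ => (ordInf Δ (g ^ n) : ℝ) / n) atTop (𝓝 k)) :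
    ∃ y : G, k ≤ ordInf Δ (y⁻¹ * g * y) := by
  simp only [H.le_ordInf_iff]
  refine exists_conj_zpow_le H fun y C hC => ?_
  have hy := H.tendsto_ordInf_conj ht y
  set h := y⁻¹ * g * y
  have hC' : (0 : ℝ) < C := by exact_mod_cast hC
  have hev := hy.eventually (lt_mem_nhds (show (k : ℝ) - 1 / C < k by
    have : 0 < 1 / (C : ℝ) := by positivity
    linarith))
  obtain ⟨I, hI⟩ := eventually_atTop.1 hev
  -- For `i ≥ I` the defect is at most `i / C ≤ j`. For `i < I` it is at most `I * |k - inf h|`,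
  -- which this `j` exceeds.
  refine ⟨I * (k - ordInf Δ h).natAbs + 1, Nat.succ_pos _, fun i hi => ?_⟩
  set j := I * (k - ordInf Δ h).natAbs + 1 with hj
  rw [← H.le_ordInf_iff]
  rcases lt_or_ge i I with hiI | hiI
  · have h1 := H.mul_ordInf_le_pow h i
    have h2 : (i : ℤ) * (k - ordInf Δ h) ≤ I * |k - ordInf Δ h| :=
      (mul_le_mul_of_nonneg_left (le_abs_self _) (Int.natCast_nonneg i)).trans
        (mul_le_mul_of_nonneg_right (by exact_mod_cast hiI.le) (abs_nonneg _))
    have h3 : (j : ℤ) = I * |k - ordInf Δ h| + 1 := by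
      rw [hj]; push_cast; rfl
    rw [h3]; linarith
  · rcases Nat.eq_zero_or_pos i with rfl | hi0
    · simp [H.ordInf_one]
    · have hi0' : (0 : ℝ) < i := by exact_mod_cast hi0
      have h1 := hI i hiI
      rw [lt_div_iff₀ hi0'] at h1
      have h2 : (i : ℝ) ≤ C * j := by exact_mod_cast hi
      have h3 : 1 / (C : ℝ) * i ≤ j := by
        rw [one_div, inv_mul_le_iff₀ hC']; exact h2
      have : (k * (i : ℤ) - j : ℝ) ≤ ordInf Δ (h ^ i) := by push_cast; linarith
      exact_mod_cast this

/-- If `h` maximises `inf` in its conjugacy class and its translation number is an integer, then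
`inf` is linear on the powers of `h`. -/
theorem ordInf_pow_eq {h : G} {k : ℤ}
    (ht : Tendsto (fun n : ℕ => (ordInf Δ (h ^ n) : ℝ) / n) atTop (𝓝 k))
    (hmax : ∀ y : G, ordInf Δ (y⁻¹ * h * y) ≤ ordInf Δ h) (n : ℕ) :
    ordInf Δ (h ^ n) = n * ordInf Δ h := by
  obtain ⟨y, hy⟩ := H.exists_le_ordInf_conj ht
  have hk : k ≤ ordInf Δ h := hy.trans (hmax y)
  obtain ⟨t, ht', hle⟩ := H.exists_tendsto_ordInf h
  obtain rfl := tendsto_nhds_unique ht ht'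
  refine le_antisymm ?_ (H.mul_ordInf_le_pow h n)
  have h1 : ordInf Δ (h ^ n) ≤ n * k := by exact_mod_cast hle n
  exact h1.trans (mul_le_mul_of_nonneg_left hk (Int.natCast_nonneg n))

end IsGarsideOrder

/-! ### Word length from `inf` and `sup` -/

section WordLength

variable {G : Type*} [Group G]

theorem wordLength_le {A : Set G} {l : List G} (hl : ∀ x ∈ l, x ∈ A ∨ x⁻¹ ∈ A) :
    wordLength A l.prod ≤ l.length :=
  Nat.sInf_le ⟨l, hl, rfl, rfl⟩

theorem inv_word {A : Set G} {l : List G} (hl : ∀ x ∈ l, x ∈ A ∨ x⁻¹ ∈ A) :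
    ∀ x ∈ (l.map (·⁻¹)).reverse, x ∈ A ∨ x⁻¹ ∈ A := by
  intro x hx
  simp only [List.mem_reverse, List.mem_map] at hx
  obtain ⟨z, hz, rfl⟩ := hx
  rw [inv_inv]
  exact (hl z hz).symm

theorem wordLength_inv (A : Set G) (g : G) : wordLength A g⁻¹ = wordLength A g := by
  unfold wordLength
  congr 1
  ext k
  constructor
  · rintro ⟨l, hl, hp, hk⟩
    exact ⟨_, inv_word hl, by rw [← List.prod_inv_reverse, hp, inv_inv], by simpa using hk⟩
  · rintro ⟨l, hl, hp, hk⟩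
    exact ⟨_, inv_word hl, by rw [← List.prod_inv_reverse, hp], by simpa using hk⟩

theorem isPeriodicallyGeodesic_of_pow {A : Set G} {g : G}
    (h : ∀ n : ℕ, wordLength A (g ^ n) = n * wordLength A g) : IsPeriodicallyGeodesic A g := by
  intro n
  obtain ⟨m, rfl | rfl⟩ := n.eq_nat_or_neg
  · simpa using h m
  · simpa [wordLength_inv] using h m

variable [Lattice G] {Δ : G} (H : IsGarsideOrder Δ)
include H

/-- Meeting `g` with `Δ ^ s` lowers the upper bound by one and splits off a simple last letter; when
`s = 0`, pass to the inverse. The length can be exactly `m` because `1` is itself a letter. -/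
theorem exists_word_of_mem_Icc (m : ℕ) : ∀ (r s : ℕ), r + s = m → ∀ g : G, Δ ^ (-(r : ℤ)) ≤ g →
    g ≤ Δ ^ (s : ℤ) → ∃ l : List G, (∀ x ∈ l, x ∈ Set.Icc 1 Δ ∨ x⁻¹ ∈ Set.Icc 1 Δ) ∧
      l.prod = g ∧ l.length = m := by
  have := H.mulLeftMono
  induction m with
  | zero =>
    intro r s hrs g hr hs
    obtain ⟨rfl, rfl⟩ : r = 0 ∧ s = 0 := by omega
    exact ⟨[], by simp, le_antisymm (by simpa using hr) (by simpa using hs), rfl⟩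
  | succ m ih =>
    have hpos : ∀ (r s : ℕ), r + (s + 1) = m + 1 → ∀ g : G, Δ ^ (-(r : ℤ)) ≤ g →
        g ≤ Δ ^ ((s + 1 : ℕ) : ℤ) → ∃ l : List G,
        (∀ x ∈ l, x ∈ Set.Icc 1 Δ ∨ x⁻¹ ∈ Set.Icc 1 Δ) ∧ l.prod = g ∧ l.length = m + 1 := by
      intro r s hrs g hr hs
      obtain ⟨l, hl, hp, hk⟩ := ih r s (by omega) (g ⊓ Δ ^ (s : ℤ))
        (le_inf hr (H.zpow_le_zpow_iff.2 (by omega))) inf_le_right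
      refine ⟨l ++ [(g ⊓ Δ ^ (s : ℤ))⁻¹ * g], ?_, by simp [hp], by simp [hk]⟩
      intro x hx
      rcases List.mem_append.1 hx with hx | hx
      · exact hl x hx
      · rw [List.mem_singleton.1 hx]
        left
        constructor
        · rw [le_inv_mul_iff_mul_le, mul_one]; exact inf_le_left
        · rw [inv_mul_le_iff_le_mul]
          have h1 : g * Δ ^ (-1 : ℤ) ≤ g ⊓ Δ ^ (s : ℤ) := by
            refine le_inf ?_ ?_
            · refine mul_le_of_le_one_right' ?_
              simpa using H.zpow_le_zpow_iff.2 (show (-1 : ℤ) ≤ 0 by norm_num)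
            · have := H.mul_zpow_mono (-1) hs
              rwa [← zpow_add, show ((s + 1 : ℕ) : ℤ) + -1 = s by push_cast; ring] at this
          simpa using (H.mul_zpow_le_iff_le_mul (-1)).1 h1
    intro r s hrs g hr hs
    rcases s with _ | s
    · obtain ⟨r, rfl⟩ : ∃ r', r = r' + 1 := ⟨r - 1, by omega⟩
      obtain ⟨l, hl, hp, hk⟩ := hpos 0 r (by omega) g⁻¹
        (by simpa using H.le_zpow_neg_iff.1 (show g ≤ Δ ^ (-(0 : ℤ)) by simpa using hs))
        (by simpa using H.inv_le_zpow_iff.2 hr)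
      exact ⟨_, inv_word hl, by rw [← List.prod_inv_reverse, hp, inv_inv], by simpa using hk⟩
    · exact hpos r s hrs g hr hs

/-- A positive letter raises `sup` by at most one and does not lower `inf`; a negative letter lowers
`inf` by at most one and does not raise `sup`. Here `a` and `b` count the two kinds. -/
theorem ordSup_ordInf_le_length {l : List G}
    (hl : ∀ x ∈ l, x ∈ Set.Icc 1 Δ ∨ x⁻¹ ∈ Set.Icc 1 Δ) :
    max 0 (ordSup Δ l.prod) + max 0 (-ordInf Δ l.prod) ≤ l.length := by
  suffices h : ∃ a b : ℕ, a + b = l.length ∧ ordSup Δ l.prod ≤ a ∧ -b ≤ ordInf Δ l.prod by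
    obtain ⟨a, b, h1, h2, h3⟩ := h
    omega
  induction l with
  | nil => exact ⟨0, 0, rfl, by simp [H.ordSup_eq, H.ordInf_one], by simp [H.ordInf_one]⟩
  | cons x l ih =>
    obtain ⟨a, b, h1, h2, h3⟩ := ih fun z hz => hl z (List.mem_cons_of_mem _ hz)
    have hs := H.ordSup_le_add x l.prod
    have hi := H.ordInf_add_le x l.prod
    rw [List.prod_cons, List.length_cons]
    rcases hl x List.mem_cons_self with hx | hx
    · have hx1 : 0 ≤ ordInf Δ x := H.le_ordInf_iff.2 (by simpa using hx.1)
      have hx2 : ordSup Δ x ≤ 1 := H.ordSup_le_iff.2 (by simpa using hx.2)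
      exact ⟨a + 1, b, by omega, by push_cast; linarith, by linarith⟩
    · have hx1 : ordSup Δ x ≤ 0 := by
        rw [H.ordSup_eq]
        have : 0 ≤ ordInf Δ x⁻¹ := H.le_ordInf_iff.2 (by simpa using hx.1)
        linarith
      have hx2 : -1 ≤ ordInf Δ x := by
        rw [H.le_ordInf_iff, ← H.inv_le_zpow_iff]; simpa using hx.2
      exact ⟨a, b + 1, by omega, by linarith, by push_cast; linarith⟩

theorem wordLength_eq (g : G) :
    (wordLength (Set.Icc 1 Δ) g : ℤ) = max 0 (ordSup Δ g) + max 0 (-ordInf Δ g) := by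
  obtain ⟨l, hl, hp, hk⟩ := exists_word_of_mem_Icc H _ (max 0 (-ordInf Δ g)).toNat
    (max 0 (ordSup Δ g)).toNat rfl g (H.le_ordInf_iff.1 (by omega)) (H.ordSup_le_iff.1 (by omega))
  apply le_antisymm
  · have := wordLength_le hl
    rw [hp, hk] at this
    omega
  · obtain ⟨l', hl', hp', hk'⟩ := Nat.sInf_mem (s := {k : ℕ | ∃ l : List G,
      (∀ x ∈ l, x ∈ Set.Icc 1 Δ ∨ x⁻¹ ∈ Set.Icc 1 Δ) ∧ l.prod = g ∧ l.length = k})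
      ⟨_, l, hl, hp, hk⟩
    have := ordSup_ordInf_le_length H hl'
    rw [hp', hk'] at this
    exact this

theorem isPeriodicallyGeodesic_of_ordInf_pow {h : G}
    (hcase : (0 ≤ ordInf Δ h ∧ ∀ n : ℕ, ordInf Δ (h⁻¹ ^ n) = n * ordInf Δ h⁻¹) ∨
      (ordSup Δ h ≤ 0 ∧ ∀ n : ℕ, ordInf Δ (h ^ n) = n * ordInf Δ h) ∨
      ((∀ n : ℕ, ordInf Δ (h ^ n) = n * ordInf Δ h) ∧
        ∀ n : ℕ, ordInf Δ (h⁻¹ ^ n) = n * ordInf Δ h⁻¹)) :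
    IsPeriodicallyGeodesic (Set.Icc 1 Δ) h := by
  refine isPeriodicallyGeodesic_of_pow fun n => ?_
  have hn : (0 : ℤ) ≤ n := Int.natCast_nonneg n
  have hsup : (∀ n : ℕ, ordInf Δ (h⁻¹ ^ n) = n * ordInf Δ h⁻¹) →
      ordSup Δ (h ^ n) = n * ordSup Δ h := fun hh => by
    rw [H.ordSup_eq, H.ordSup_eq, ← inv_pow, hh]; ring
  have hmul : ∀ x : ℤ, max 0 (n * x) = n * max 0 x := fun x => by
    rw [mul_max_of_nonneg _ _ hn, mul_zero]
  zify
  rw [wordLength_eq H, wordLength_eq H]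
  rcases hcase with ⟨h0, h1⟩ | ⟨h0, h1⟩ | ⟨h0, h1⟩
  · have h2 : 0 ≤ ordInf Δ (h ^ n) := (mul_nonneg hn h0).trans (H.mul_ordInf_le_pow h n)
    rw [hsup h1, hmul, max_eq_left (by linarith : -ordInf Δ (h ^ n) ≤ 0),
      max_eq_left (by linarith : -ordInf Δ h ≤ 0)]
    ring
  · have h2 : ordSup Δ (h ^ n) ≤ 0 :=
      (H.pow_ordSup_le_mul h n).trans (mul_nonpos_of_nonneg_of_nonpos hn h0)
    rw [h1, max_eq_left h2, max_eq_left h0, ← mul_neg, hmul]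
    ring
  · rw [hsup h1, h0, hmul, ← mul_neg, hmul]
    ring

end WordLength

/-! ### Finiteness in atomic monoids -/

section Divisors

variable {M : Type*} [Monoid M]

theorem finite_atoms (hfg : Monoid.FG M) : {a : M | IsMonoidAtom a}.Finite := by
  obtain ⟨S, hS, hfin⟩ := Monoid.fg_iff.1 hfg
  refine hfin.subset fun a ha => ?_
  obtain ⟨l, hl, rfl⟩ := Submonoid.exists_list_of_mem_closure (hS ▸ Submonoid.mem_top a)
  clear hS
  induction l with
  | nil => exact absurd rfl ha.1
  | cons x l ih =>
    rw [List.prod_cons] at ha ⊢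
    rcases ha.2 x l.prod rfl with h | h
    · rw [h, one_mul] at ha ⊢
      exact ih (fun y hy => hl y (List.mem_cons_of_mem _ hy)) ha
    · rw [h, mul_one]
      exact hl x List.mem_cons_self

theorem le_atomNorm {l : List M} (hl : ∀ x ∈ l, IsMonoidAtom x) :
    (l.length : ℕ∞) ≤ atomNorm l.prod :=
  le_iSup₂_of_le (f := fun (l' : List M)
    (_ : l' ∈ {l' : List M | (∀ x ∈ l', IsMonoidAtom x) ∧ l'.prod = l.prod}) =>
      (l'.length : ℕ∞)) l ⟨hl, rfl⟩ le_rfl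

theorem IsAtomic.exists_atoms (h : IsAtomic M) (a : M) :
    ∃ l : List M, (∀ x ∈ l, IsMonoidAtom x) ∧ l.prod = a :=
  Submonoid.exists_list_of_mem_closure (h.closure_atoms ▸ Submonoid.mem_top a)

/-- A nonempty word of atoms representing `1` could be repeated, making the norm of `1` infinite. -/
theorem IsAtomic.eq_one_of_mul_eq_one (h : IsAtomic M) {a b : M} (hab : a * b = 1) : a = 1 := by
  by_contra ha
  obtain ⟨la, hla, rfl⟩ := h.exists_atoms a
  obtain ⟨lb, hlb, rfl⟩ := h.exists_atoms b
  set l := la ++ lb with hl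
  have hl1 : l.prod = 1 := by rw [hl, List.prod_append, hab]
  have hlat : ∀ x ∈ l, IsMonoidAtom x := fun x hx =>
    (List.mem_append.1 hx).elim (hla x) (hlb x)
  have hlen : 1 ≤ l.length := by
    rcases la with _ | ⟨x, la⟩
    · exact absurd rfl ha
    · simp [hl]
  obtain ⟨N, hN⟩ := ENat.ne_top_iff_exists.1 (h.atomNorm_lt_top 1).ne
  have hrep := le_atomNorm (l := (List.replicate (N + 1) l).flatten) (fun x hx => by
    obtain ⟨l', hl', hx⟩ := List.mem_flatten.1 hx
    rw [(List.mem_replicate.1 hl').2] at hx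
    exact hlat x hx)
  rw [List.prod_flatten, List.map_replicate, List.prod_replicate, hl1, one_pow, ← hN,
    List.length_flatten, List.map_replicate, List.sum_replicate, smul_eq_mul] at hrep
  have : (N + 1) * l.length ≤ N := by exact_mod_cast hrep
  nlinarith

theorem IsAtomic.finite_divisors (h : IsAtomic M) (hfg : Monoid.FG M) (b : M) :
    {a : M | LeL a b}.Finite := by
  obtain ⟨N, hN⟩ := ENat.ne_top_iff_exists.1 (h.atomNorm_lt_top b).ne
  have hfin := finite_atoms hfg
  have : Finite {a : M // IsMonoidAtom a} := hfin
  refine ((List.finite_length_le {a : M // IsMonoidAtom a} N).image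
    fun l => (l.map Subtype.val).prod).subset ?_
  rintro a ⟨c, rfl⟩
  obtain ⟨la, hla, rfl⟩ := h.exists_atoms a
  obtain ⟨lc, hlc, rfl⟩ := h.exists_atoms c
  have hle := le_atomNorm (l := la ++ lc) fun x hx => (List.mem_append.1 hx).elim (hla x) (hlc x)
  rw [List.prod_append, ← hN] at hle
  have hle' : (la ++ lc).length ≤ N := by exact_mod_cast hle
  lift la to List {a : M // IsMonoidAtom a} using hla
  refine ⟨la, ?_, rfl⟩
  simp only [List.length_append, List.length_map] at hle'
  change la.length ≤ N
  omega

end Divisors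

/-! ### The lattice order of a Garside group -/

section Order

variable {G : Type*} [Group G] {P : Submonoid G} {Δ : P}

theorem groupLeL_iff {g h : G} : GroupLeL P g h ↔ g⁻¹ * h ∈ P :=
  ⟨by rintro ⟨c, hc, rfl⟩; simpa using hc, fun hc => ⟨_, hc, by simp⟩⟩

theorem groupLeL_coe_iff {a b : P} : GroupLeL P (a : G) b ↔ LeL a b :=
  ⟨fun ⟨c, hc, h⟩ => ⟨⟨c, hc⟩, Subtype.ext h⟩, fun ⟨c, h⟩ => ⟨c, c.2, by rw [← h]; rfl⟩⟩

theorem groupLeL_mul_left_iff (x : G) {g h : G} :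
    GroupLeL P (x * g) (x * h) ↔ GroupLeL P g h := by
  rw [groupLeL_iff, groupLeL_iff]
  simp [mul_assoc]

theorem groupLeL_one_iff {g : G} : GroupLeL P 1 g ↔ g ∈ P := by
  simp [groupLeL_iff]

theorem GroupLeL.trans {a b c : G} (h1 : GroupLeL P a b) (h2 : GroupLeL P b c) :
    GroupLeL P a c := by
  rw [groupLeL_iff] at *
  simpa [mul_assoc] using P.mul_mem h1 h2

variable (hG : IsGarsideGroup P Δ)
include hG

/-- For a simple `d`, take complements twice: `d * e = Δ = e * f` gives `Δ⁻¹ * d * Δ = f`. Simple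
elements generate `P`. -/
theorem IsGarsideGroup.inv_mul_mul_mem {p : G} (hp : p ∈ P) : (Δ : G)⁻¹ * p * Δ ∈ P := by
  have h : ∀ p : P, (Δ : G)⁻¹ * p * Δ ∈ P := fun p => by
    induction (hG.garsideElement.closure_divisors ▸ Submonoid.mem_top p :
      p ∈ Submonoid.closure {a : P | LeL a Δ}) using Submonoid.closure_induction with
    | mem d hd =>
      obtain ⟨e, he⟩ := hd
      obtain ⟨f, hf⟩ := (hG.garsideElement.leL_iff_leR e).2 ⟨d, he⟩
      have h1 : (d : G) * e = Δ := congrArg Subtype.val he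
      have h2 : (e : G) * f = Δ := congrArg Subtype.val hf
      have h3 : (Δ : G)⁻¹ * d * Δ = f := by
        rw [mul_assoc, inv_mul_eq_iff_eq_mul]
        nth_rewrite 1 [← h2]
        rw [← mul_assoc, h1]
      rw [h3]; exact f.2
    | one => simp
    | mul x y _ _ hx hy =>
      have := P.mul_mem hx hy
      simpa [mul_assoc] using this
  exact h ⟨p, hp⟩

theorem IsGarsideGroup.mul_mul_inv_mem {p : G} (hp : p ∈ P) : (Δ : G) * p * (Δ : G)⁻¹ ∈ P := by
  have h : ∀ p : P, (Δ : G) * p * (Δ : G)⁻¹ ∈ P := fun p => by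
    induction (hG.garsideElement.closure_divisors ▸ Submonoid.mem_top p :
      p ∈ Submonoid.closure {a : P | LeL a Δ}) using Submonoid.closure_induction with
    | mem d hd =>
      obtain ⟨e, he⟩ := (hG.garsideElement.leL_iff_leR d).1 hd
      obtain ⟨f, hf⟩ := (hG.garsideElement.leL_iff_leR e).1 ⟨d, he⟩
      have h1 : (e : G) * d = Δ := congrArg Subtype.val he
      have h2 : (f : G) * e = Δ := congrArg Subtype.val hf
      have h3 : (Δ : G) * d * (Δ : G)⁻¹ = f := by
        rw [mul_inv_eq_iff_eq_mul]
        nth_rewrite 1 [← h2]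
        rw [mul_assoc, h1]
      rw [h3]; exact f.2
    | one => simp
    | mul x y _ _ hx hy =>
      have := P.mul_mem hx hy
      simpa [mul_assoc] using this
  exact h ⟨p, hp⟩

theorem IsGarsideGroup.exists_pow_mul_eq (a : P) : ∃ (n : ℕ) (c : P), c * a = Δ ^ n := by
  have : ∀ n : ℕ, ∀ p ∈ P, ((Δ : G) ^ n) * p * ((Δ : G) ^ n)⁻¹ ∈ P := fun n => by
    induction n with
    | zero => simp
    | succ n ih =>
      intro p hp
      have := ih _ (hG.mul_mul_inv_mem hp)
      simpa [pow_succ, mul_assoc] using this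
  induction (hG.garsideElement.closure_divisors ▸ Submonoid.mem_top a :
      a ∈ Submonoid.closure {a : P | LeL a Δ}) using Submonoid.closure_induction with
  | mem d hd =>
    obtain ⟨e, he⟩ := (hG.garsideElement.leL_iff_leR d).1 hd
    exact ⟨1, e, by simpa using he⟩
  | one => exact ⟨0, 1, by simp⟩
  | mul x y _ _ hx hy =>
    obtain ⟨n, c, hc⟩ := hx
    obtain ⟨m, d, hd⟩ := hy
    have hd' : (d : G) * y = (Δ : G) ^ m := congrArg Subtype.val hd
    have hc' : (c : G) * x = (Δ : G) ^ n := congrArg Subtype.val hc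
    refine ⟨n + m, ⟨_, this n d d.2⟩ * c, Subtype.ext ?_⟩
    change (Δ : G) ^ n * d * ((Δ : G) ^ n)⁻¹ * c * (x * y) = (Δ : G) ^ (n + m)
    rw [pow_add, ← hd', ← hc']
    group

theorem IsGarsideGroup.exists_pow_mul_mem (g : G) : ∃ n : ℕ, (Δ : G) ^ n * g ∈ P := by
  obtain ⟨a, b, rfl⟩ := hG.fraction g
  obtain ⟨n, c, hc⟩ := hG.exists_pow_mul_eq a
  have hc' : (c : G) * a = (Δ : G) ^ n := congrArg Subtype.val hc
  refine ⟨n, ?_⟩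
  rw [← hc', mul_assoc, mul_inv_cancel_left]
  exact P.mul_mem c.2 b.2

theorem IsGarsideGroup.exists_pow_mul_mem_pair (g h : G) :
    ∃ n : ℕ, (Δ : G) ^ n * g ∈ P ∧ (Δ : G) ^ n * h ∈ P := by
  obtain ⟨n, hn⟩ := hG.exists_pow_mul_mem g
  obtain ⟨m, hm⟩ := hG.exists_pow_mul_mem h
  refine ⟨n + m, ?_, ?_⟩
  · rw [add_comm, pow_add, mul_assoc]
    exact P.mul_mem (P.pow_mem Δ.2 m) hn
  · rw [pow_add, mul_assoc]
    exact P.mul_mem (P.pow_mem Δ.2 n) hm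

theorem IsGarsideGroup.groupLeL_antisymm {a b : G} (h1 : GroupLeL P a b) (h2 : GroupLeL P b a) :
    a = b := by
  rw [groupLeL_iff] at h1 h2
  have h := hG.garsideMonoid.atomic.eq_one_of_mul_eq_one
    (a := ⟨_, h1⟩) (b := ⟨_, h2⟩) (Subtype.ext (by simp))
  exact inv_mul_eq_one.1 (congrArg Subtype.val h)

/-- A left translation by a power of `Δ` makes both elements positive, and then so is every common
upper bound. -/
theorem IsGarsideGroup.exists_join (x y : G) : ∃ j : G, GroupLeL P x j ∧ GroupLeL P y j ∧
    ∀ c, GroupLeL P x c → GroupLeL P y c → GroupLeL P j c := by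
  obtain ⟨n, hx, hy⟩ := hG.exists_pow_mul_mem_pair x y
  obtain ⟨j, h1, h2, h3⟩ := hG.garsideMonoid.lattice_leL.exists_sup ⟨_, hx⟩ ⟨_, hy⟩
  rw [← groupLeL_coe_iff] at h1 h2
  refine ⟨((Δ : G) ^ n)⁻¹ * j, ?_, ?_, fun c hc hc' => ?_⟩
  · rw [← groupLeL_mul_left_iff ((Δ : G) ^ n)]; simpa using h1
  · rw [← groupLeL_mul_left_iff ((Δ : G) ^ n)]; simpa using h2
  · rw [← groupLeL_mul_left_iff ((Δ : G) ^ n)] at hc hc' ⊢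
    have hmem : (Δ : G) ^ n * c ∈ P :=
      groupLeL_one_iff.1 ((groupLeL_one_iff.2 hx).trans hc)
    have := groupLeL_coe_iff.2 (h3 ⟨_, hmem⟩ (groupLeL_coe_iff.1 hc) (groupLeL_coe_iff.1 hc'))
    simpa using this

theorem IsGarsideGroup.exists_meet (x y : G) : ∃ m : G, GroupLeL P m x ∧ GroupLeL P m y ∧
    ∀ c, GroupLeL P c x → GroupLeL P c y → GroupLeL P c m := by
  obtain ⟨n, hx, hy⟩ := hG.exists_pow_mul_mem_pair x y
  obtain ⟨m, h1, h2, h3⟩ := hG.garsideMonoid.lattice_leL.exists_inf ⟨_, hx⟩ ⟨_, hy⟩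
  rw [← groupLeL_coe_iff] at h1 h2
  refine ⟨((Δ : G) ^ n)⁻¹ * m, ?_, ?_, fun c hc hc' => ?_⟩
  · rw [← groupLeL_mul_left_iff ((Δ : G) ^ n)]; simpa using h1
  · rw [← groupLeL_mul_left_iff ((Δ : G) ^ n)]; simpa using h2
  · rw [← groupLeL_mul_left_iff ((Δ : G) ^ n)] at hc hc' ⊢
    rw [mul_inv_cancel_left]
    -- A common lower bound need not be positive after translation. Its join with `m` is positive
    -- and still a lower bound.
    obtain ⟨j, hj1, hj2, hj3⟩ := hG.exists_join ((Δ : G) ^ n * c) m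
    have hmem : j ∈ P := groupLeL_one_iff.1 ((groupLeL_one_iff.2 m.2).trans hj2)
    have := groupLeL_coe_iff.2 (h3 ⟨j, hmem⟩ (groupLeL_coe_iff.1 (hj3 _ hc h1))
      (groupLeL_coe_iff.1 (hj3 _ hc' h2)))
    exact hj1.trans this

/-- The lattice structure on a Garside group given by `≤_L`. -/
@[reducible]
noncomputable def IsGarsideGroup.lattice : Lattice G where
  le := GroupLeL P
  le_refl a := ⟨1, P.one_mem, mul_one a⟩
  le_trans _ _ _ := GroupLeL.trans
  le_antisymm _ _ := hG.groupLeL_antisymm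
  sup x y := (hG.exists_join x y).choose
  le_sup_left x y := (hG.exists_join x y).choose_spec.1
  le_sup_right x y := (hG.exists_join x y).choose_spec.2.1
  sup_le x y c := (hG.exists_join x y).choose_spec.2.2 c
  inf x y := (hG.exists_meet x y).choose
  inf_le_left x y := (hG.exists_meet x y).choose_spec.1
  inf_le_right x y := (hG.exists_meet x y).choose_spec.2.1
  le_inf c x y := (hG.exists_meet x y).choose_spec.2.2 c

theorem IsGarsideGroup.garside_ne_one [Nontrivial G] : (Δ : G) ≠ 1 := by
  intro h
  have hΔ : Δ = 1 := Subtype.ext h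
  have htop : ∀ p : P, p = 1 := fun p => by
    have hp : p ∈ Submonoid.closure {a : P | LeL a Δ} :=
      hG.garsideElement.closure_divisors ▸ Submonoid.mem_top p
    have hsub : {a : P | LeL a Δ} ⊆ {1} := fun a ⟨c, hc⟩ =>
      hG.garsideMonoid.atomic.eq_one_of_mul_eq_one (hc.trans hΔ)
    exact Submonoid.mem_bot.1
      ((Submonoid.closure_le (S := ⊥)).2 (fun a ha => Submonoid.mem_bot.2 (hsub ha)) hp)
  obtain ⟨g, hg⟩ := exists_ne (1 : G)
  obtain ⟨a, b, rfl⟩ := hG.fraction g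
  exact hg (by simp [htop a, htop b])

theorem IsGarsideGroup.isGarsideOrder [Nontrivial G] :
    @IsGarsideOrder G _ hG.lattice (Δ : G) := by
  let _ := hG.lattice
  have hle : ∀ {x y : G}, x ≤ y ↔ GroupLeL P x y := Iff.rfl
  exact
    { mulLeftMono := ⟨fun x _ _ h => (groupLeL_mul_left_iff x).2 h⟩
      one_lt := lt_of_le_of_ne (groupLeL_one_iff.2 Δ.2) hG.garside_ne_one.symm
      mul_right_le := fun {x y} h => by
        rw [hle, groupLeL_iff] at h ⊢
        simpa [mul_assoc] using hG.inv_mul_mul_mem h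
      mul_right_inv_le := fun {x y} h => by
        rw [hle, groupLeL_iff] at h ⊢
        simpa [mul_assoc] using hG.mul_mul_inv_mem h
      exists_zpow_le := fun g => by
        obtain ⟨n, hn⟩ := hG.exists_pow_mul_mem g
        exact ⟨-n, by rw [hle, groupLeL_iff]; simpa using hn⟩
      finite_Icc := fun a b => by
        by_cases hab : a ≤ b
        · have hb : a⁻¹ * b ∈ P := groupLeL_iff.1 hab
          refine ((hG.garsideMonoid.atomic.finite_divisors hG.garsideMonoid.fg ⟨_, hb⟩).image
            fun p : P => a * p).subset fun x hx => ?_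
          have hx1 : a⁻¹ * x ∈ P := groupLeL_iff.1 hx.1
          exact ⟨⟨_, hx1⟩, groupLeL_coe_iff.1 ((groupLeL_mul_left_iff _).2 hx.2), by simp⟩
        · rw [Set.Icc_eq_empty hab]; exact Set.finite_empty }

theorem IsGarsideGroup.simples_eq : simples P Δ = @Set.Icc G hG.lattice.toPreorder 1 (Δ : G) := by
  ext x
  constructor
  · rintro ⟨a, ha, rfl⟩
    exact ⟨groupLeL_one_iff.2 a.2, groupLeL_coe_iff.2 ha⟩
  · rintro ⟨h1, h2⟩
    exact ⟨⟨x, groupLeL_one_iff.1 h1⟩, groupLeL_coe_iff.1 h2, rfl⟩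

end Order

/-! ### Extrema over a conjugacy class -/

section Conjugacy

variable {G : Type*} [Group G] [Lattice G] {Δ : G} (H : IsGarsideOrder Δ)
include H

theorem exists_tendsto_ordInf_and_le_conj (g : G) :
    ∃ t : ℝ, Tendsto (fun n : ℕ => (ordInf Δ (g ^ n) : ℝ) / n) atTop (𝓝 t) ∧
      ∀ y : G, (ordInf Δ (y⁻¹ * g * y) : ℝ) ≤ t := by
  obtain ⟨t, ht, -⟩ := H.exists_tendsto_ordInf g
  refine ⟨t, ht, fun y => ?_⟩
  obtain ⟨t', ht', h⟩ := H.exists_tendsto_ordInf (y⁻¹ * g * y)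
  obtain rfl := tendsto_nhds_unique ht' (H.tendsto_ordInf_conj ht y)
  simpa using h 1

theorem ordInf_pow_eq_of_limUnder {g : G} {k : ℤ}
    (hk : limUnder atTop (fun n : ℕ => (ordInf Δ (g ^ n) : ℝ) / n) = k) {y : G}
    (hmax : ∀ z : G, ordInf Δ (z⁻¹ * g * z) ≤ ordInf Δ (y⁻¹ * g * y)) (n : ℕ) :
    ordInf Δ ((y⁻¹ * g * y) ^ n) = n * ordInf Δ (y⁻¹ * g * y) := by
  obtain ⟨t, ht, -⟩ := H.exists_tendsto_ordInf g
  rw [ht.limUnder_eq] at hk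
  subst hk
  refine H.ordInf_pow_eq (H.tendsto_ordInf_conj ht y) (fun z => ?_) n
  have := hmax (y * z)
  rwa [show (y * z)⁻¹ * g * (y * z) = z⁻¹ * (y⁻¹ * g * y) * z by group] at this

theorem limUnder_ordSup (g : G) :
    limUnder atTop (fun n : ℕ => (ordSup Δ (g ^ n) : ℝ) / n) =
      -limUnder atTop (fun n : ℕ => (ordInf Δ (g⁻¹ ^ n) : ℝ) / n) := by
  obtain ⟨t, ht, -⟩ := H.exists_tendsto_ordInf g⁻¹
  rw [ht.limUnder_eq]
  refine (ht.neg.congr fun n => ?_).limUnder_eq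
  rw [H.ordSup_eq, inv_pow]
  push_cast; ring

/-- The translation number bounds `inf` on the whole class, so the integer `sSup` is not a default
value. -/
theorem ordInf_conj_le_sSup (g z : G) :
    ordInf Δ (z⁻¹ * g * z) ≤ sSup (ordInf Δ '' conjugatesOf g) := by
  refine le_csSup ?_ ⟨_, isConj_iff.2 ⟨z⁻¹, by simp⟩, rfl⟩
  obtain ⟨t, -, h⟩ := exists_tendsto_ordInf_and_le_conj H g
  refine ⟨⌊t⌋, ?_⟩
  rintro _ ⟨x, hx, rfl⟩
  obtain ⟨c, rfl⟩ := isConj_iff.1 hx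
  simpa [Int.le_floor] using h c⁻¹

theorem sInf_le_ordSup_conj (g z : G) :
    sInf (ordSup Δ '' conjugatesOf g) ≤ ordSup Δ (z⁻¹ * g * z) := by
  refine csInf_le ?_ ⟨_, isConj_iff.2 ⟨z⁻¹, by simp⟩, rfl⟩
  obtain ⟨t, -, h⟩ := exists_tendsto_ordInf_and_le_conj H g⁻¹
  refine ⟨-⌊t⌋, ?_⟩
  rintro _ ⟨x, hx, rfl⟩
  obtain ⟨c, rfl⟩ := isConj_iff.1 hx
  rw [H.ordSup_eq, neg_le_neg_iff, Int.le_floor]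
  simpa [mul_assoc] using h c⁻¹

end Conjugacy

end Garside

theorem lemma4p1 {G : Type*} [Group G] (P : Submonoid G) (Δ : P)
    (hG : Garside.IsGarsideGroup P Δ) (g : G)
    (hg : (0 ≤ Garside.infS P Δ g ∧ ∃ k : ℤ, Garside.tSup P Δ g = (k : ℝ)) ∨
      (Garside.supS P Δ g ≤ 0 ∧ ∃ k : ℤ, Garside.tInf P Δ g = (k : ℝ)) ∨
      ((∃ k : ℤ, Garside.tInf P Δ g = (k : ℝ)) ∧ ∃ k : ℤ, Garside.tSup P Δ g = (k : ℝ))) :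
    ∀ h ∈ Garside.superSummitSet P Δ g,
      Garside.IsPeriodicallyGeodesic (Garside.simples P Δ) h := by
  intro h hh
  -- In the trivial group `Δ = 1`, so `1 < Δ` fails and this case is separate.
  rcases subsingleton_or_nontrivial G with hS | hN
  · have h0 : Garside.wordLength (Garside.simples P Δ) h = 0 := by
      have := Garside.wordLength_le (A := Garside.simples P Δ) (l := []) (by simp)
      rw [Subsingleton.elim h ([] : List G).prod]
      simpa using this
    intro n
    rw [Subsingleton.elim (h ^ n) h, h0, mul_zero]
  -- For this order `≤` is `GroupLeL P` by definition, so `inf` and `sup` agree definitionally with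
  -- `ordInf` and `ordSup`.
  let _ := hG.lattice
  have H : Garside.IsGarsideOrder (Δ : G) := hG.isGarsideOrder
  obtain ⟨hconj, hinf, hsup⟩ := hh
  obtain ⟨c, rfl⟩ := isConj_iff.1 hconj
  obtain ⟨y, rfl⟩ : ∃ y, c = y⁻¹ := ⟨c⁻¹, by simp⟩
  rw [inv_inv] at hinf hsup ⊢
  rw [hG.simples_eq]
  have hI : (∃ k : ℤ, Garside.tInf P Δ g = (k : ℝ)) → ∀ n : ℕ,
      Garside.ordInf (Δ : G) ((y⁻¹ * g * y) ^ n) = n * Garside.ordInf (Δ : G) (y⁻¹ * g * y) := by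
    rintro ⟨k, hk⟩
    exact Garside.ordInf_pow_eq_of_limUnder H hk fun z =>
      (Garside.ordInf_conj_le_sSup H g z).trans hinf.ge
  have hS : (∃ k : ℤ, Garside.tSup P Δ g = (k : ℝ)) → ∀ n : ℕ,
      Garside.ordInf (Δ : G) ((y⁻¹ * g * y)⁻¹ ^ n) =
        n * Garside.ordInf (Δ : G) (y⁻¹ * g * y)⁻¹ := by
    rintro ⟨k, hk⟩
    have hk' : -Filter.limUnder Filter.atTop
        (fun n : ℕ => (Garside.ordInf (Δ : G) (g⁻¹ ^ n) : ℝ) / n) = k :=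
      (Garside.limUnder_ordSup H g).symm.trans hk
    have hinv : ∀ z : G, (z⁻¹ * g * z)⁻¹ = z⁻¹ * g⁻¹ * z := fun z => by group
    rw [hinv]
    -- Duality: `t_sup(g) = -t_inf(g⁻¹)`, and minimising `sup` over the class of `g` is maximising
    -- `inf` over that of `g⁻¹`.
    refine Garside.ordInf_pow_eq_of_limUnder (k := -k) H (by push_cast; linarith) fun z => ?_
    have h1 := hsup.le.trans (Garside.sInf_le_ordSup_conj H g z)
    change Garside.ordSup (Δ : G) _ ≤ _ at h1
    rw [H.ordSup_eq, H.ordSup_eq, hinv, hinv] at h1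
    linarith
  refine Garside.isPeriodicallyGeodesic_of_ordInf_pow H ?_
  rcases hg with ⟨h0, h1⟩ | ⟨h0, h1⟩ | ⟨h0, h1⟩
  · exact Or.inl ⟨h0.trans hinf.ge, hS h1⟩
  · exact Or.inr (Or.inl ⟨hsup.le.trans h0, hI h1⟩)
  · exact Or.inr (Or.inr ⟨hI h0, hS h1⟩)
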